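/- Let $H$ be a complex Hilbert space with an orthonormal basis $(e_n)_{n\in\mathbb Z}$, and let $S$ be a bilateral weighted shift on $H$, that is, a bounded linear operator with $Se_n=\omega_n e_{n+1}$ for all $n\in\mathbb Z$, where $(\omega_n)_{n\in\mathbb Z}$ is a bounded sequence of positive reals. Put $\beta_0=1$, $\beta_n=\omega_0\cdots\omega_{n-1}$ for $n>0$, $\beta_n=\frac{1}{\omega_n\cdots\omega_{-1}}$ for $n<0$, and $$r_2^-(S)=\liminf_{n\to+\infty}\Big[\frac1{\beta_{-n}}\Big]^{1/n},\qquad r_3^+(S)=\limsup_{n\to+\infty}\,[\beta_n]^{1/n}.$$ For a nonzero $x=\sum_{n\in\mathbb Z}a_ne_n\in H$ put $$R_\omega^-(x)=\limsup_{n\to+\infty}\Big|\frac{a_{-n}}{\beta_{-n}}\Big|^{1/n},\qquad R_\omega^+(x)=\liminf_{n\to+\infty}\Big|\frac{\beta_n}{a_n}\Big|^{1/n}\in[0,+\infty],$$ where $|\beta_n/a_n|=+\infty$ if $a_n=0$. Let $\sigma_S(x)$ be the local spectrum of $S$ at $x$, that is, the complement in $\mathbb C$ of the union of all open sets $U\subset\mathbb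 C$ for which there is an analytic function $f:U\to H$ with $(S-\lambda)f(\lambda)=x$ for all $\lambda\in U$. Assume that $r_2^-(S)\le r_3^+(S)$. Then for every nonzero $x\in H$: (a) If $R_\omega^-(x)<r_2^-(S)$ and $r_3^+(S)<R_\omega^+(x)$, then $$\sigma_S(x)=\{\lambda\in\mathbb C: r_2^-(S)\le|\lambda|\le r_3^+(S)\}.$$ (b) Otherwise, $$\{\lambda\in\mathbb C:\max(R_\omega^-(x),r_2^-(S))<|\lambda|<\min(R_\omega^+(x),r_3^+(S))\}\subset\sigma_S(x).$$ -/

import Mathlib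

open Filter
open scoped ENNReal

noncomputable section

/-- The local resolvent set of a bounded operator `T` at `x`: the union of all open sets `U ⊆ ℂ` on
which there is an analytic `f` with `(T - μ) f(μ) = x` for all `μ ∈ U`. -/
def localResolventSet {H : Type*} [NormedAddCommGroup H] [NormedSpace ℂ H]
    (T : H →L[ℂ] H) (x : H) : Set ℂ :=
  ⋃₀ {U : Set ℂ | IsOpen U ∧
    ∃ f : ℂ → H, AnalyticOnNhd ℂ f U ∧ ∀ μ ∈ U, T (f μ) - μ • f μ = x}

/-- The local spectrum `σ_T(x)`. -/
def localSpectrum {H : Type*} [NormedAddCommGroup H] [NormedSpace ℂ H]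
    (T : H →L[ℂ] H) (x : H) : Set ℂ :=
  (localResolventSet T x)ᶜ

/-- `S` is the bilateral weighted shift with positive weight sequence `ω` relative to the
orthonormal basis `e`. As `S` is a bounded operator, `ω n = ‖S (e n)‖ ≤ ‖S‖`, so that the
weight sequence is bounded. -/
structure IsBilateralWeightedShift {H : Type*} [NormedAddCommGroup H] [InnerProductSpace ℂ H]
    (S : H →L[ℂ] H) (e : HilbertBasis ℤ ℂ H) (ω : ℤ → ℝ) : Prop where
  weight_pos : ∀ n, 0 < ω n
  apply_basis : ∀ n, S (e n) = (ω n : ℂ) • e (n + 1)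

/-- `β_n = ω_0 ⋯ ω_{n-1}` for `n ≥ 0` (so `β_0 = 1`), `β_n = 1 / (ω_n ⋯ ω_{-1})` for `n < 0`. -/
def shiftBeta (ω : ℤ → ℝ) (n : ℤ) : ℝ :=
  if 0 ≤ n then ∏ i ∈ Finset.Ico 0 n, ω i else (∏ i ∈ Finset.Ico n 0, ω i)⁻¹

/-- `r_2^- = liminf_{n → +∞} (1 / β_{-n}) ^ (1 / n)`. -/
def rTwoMinus (ω : ℤ → ℝ) : ℝ≥0∞ :=
  liminf (fun n : ℕ => ENNReal.ofReal (1 / shiftBeta ω (-(n : ℤ))) ^ (1 / (n : ℝ))) atTop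

/-- `r_3^+ = limsup_{n → +∞} (β_n) ^ (1 / n)`. -/
def rThreePlus (ω : ℤ → ℝ) : ℝ≥0∞ :=
  limsup (fun n : ℕ => ENNReal.ofReal (shiftBeta ω (n : ℤ)) ^ (1 / (n : ℝ))) atTop

/-- `R_ω^-(x) = limsup_{n → +∞} |a_{-n} / β_{-n}| ^ (1 / n)`, where `x = ∑ a_n e_n`. -/
def RMinus {H : Type*} [NormedAddCommGroup H] [InnerProductSpace ℂ H]
    (e : HilbertBasis ℤ ℂ H) (ω : ℤ → ℝ) (x : H) : ℝ≥0∞ :=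
  limsup (fun n : ℕ =>
    (‖e.repr x (-(n : ℤ))‖ₑ / ENNReal.ofReal (shiftBeta ω (-(n : ℤ)))) ^ (1 / (n : ℝ))) atTop

/-- `R_ω^+(x) = liminf_{n → +∞} |β_n / a_n| ^ (1 / n)`, where `x = ∑ a_n e_n`. The value is in
`[0, +∞]`, and the `n`-th term is `+∞` when `a_n = 0` (for `n ≥ 1`). -/
def RPlus {H : Type*} [NormedAddCommGroup H] [InnerProductSpace ℂ H]
    (e : HilbertBasis ℤ ℂ H) (ω : ℤ → ℝ) (x : H) : ℝ≥0∞ :=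
  liminf (fun n : ℕ =>
    (ENNReal.ofReal (shiftBeta ω (n : ℤ)) / ‖e.repr x (n : ℤ)‖ₑ) ^ (1 / (n : ℝ))) atTop

end

/-! After dividing the `n`-th coordinate by `β_n`, the shift becomes multiplication by the variable
on formal Laurent series. Write `c_n = a_n / β_n` for the series of `x` and `d_n` for that of a
solution `y` of `(S - z) y = x`; then `d_{n-1} - z d_n = c_n`, so `y` is determined by its
coordinate at `0`. The series of `x` converges for `R_ω^-(x) < |z| < R_ω^+(x)`.

Existence, in case (a): the tails of the series solve the recurrence for `|z| < r_2^-`, and the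
negated heads solve it for `|z| > r_3^+`. Estimates at two radii, one below `r_2^-` and one above
`r_3^+`, make the solutions summable (`summable_shiftBeta_mul_min`).

Obstruction, in both cases: if `|z| < r_3^+`, square summability of `y` forces its coordinate at `0`
to be the tail (`repr_zero_eq_laurentTail`); if `|z| > r_2^-`, it forces the negated head
(`repr_zero_eq_neg_laurentHead`). An analytic local solution near a point of the closed annulus thus
makes tail plus head, which is the series divided by `z`, vanish on an open set. Then all `c_n` are
zero (`laurent_coeff_eq_zero`), hence `x = 0`. -/

/-! ### Root limits as power bounds -/

theorem rpow_one_div_lt_coe_iff {n : ℕ} (hn : n ≠ 0) (u t : ℝ≥0∞) :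
    u ^ (1 / (n : ℝ)) < t ↔ u < t ^ n := by
  have h : (0 : ℝ) < n := by positivity
  rw [one_div, ENNReal.rpow_inv_lt_iff h, ENNReal.rpow_natCast]

theorem coe_lt_rpow_one_div_iff {n : ℕ} (hn : n ≠ 0) (u t : ℝ≥0∞) :
    t < u ^ (1 / (n : ℝ)) ↔ t ^ n < u := by
  have h : (0 : ℝ) < n := by positivity
  rw [one_div, ENNReal.lt_rpow_inv_iff h, ENNReal.rpow_natCast]

theorem eventually_lt_pow_of_limsup_rpow_lt {u : ℕ → ℝ≥0∞} {t : ℝ≥0∞}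
    (h : limsup (fun n : ℕ => u n ^ (1 / (n : ℝ))) atTop < t) : ∀ᶠ n in atTop, u n < t ^ n := by
  -- The index `0` is discarded: there `1 / n = 0`, and the root carries no information.
  filter_upwards [eventually_lt_of_limsup_lt h, eventually_ne_atTop 0] with n h1 h2
  rwa [rpow_one_div_lt_coe_iff h2] at h1

theorem frequently_pow_lt_of_lt_limsup_rpow {u : ℕ → ℝ≥0∞} {t : ℝ≥0∞}
    (h : t < limsup (fun n : ℕ => u n ^ (1 / (n : ℝ))) atTop) : ∃ᶠ n in atTop, t ^ n < u n := by
  refine ((frequently_lt_of_lt_limsup (by isBoundedDefault) h).and_eventually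
    (eventually_ne_atTop 0)).mono ?_
  rintro n ⟨h1, h2⟩
  rwa [coe_lt_rpow_one_div_iff h2] at h1

theorem eventually_pow_lt_of_lt_liminf_rpow {u : ℕ → ℝ≥0∞} {t : ℝ≥0∞}
    (h : t < liminf (fun n : ℕ => u n ^ (1 / (n : ℝ))) atTop) : ∀ᶠ n in atTop, t ^ n < u n := by
  filter_upwards [eventually_lt_of_lt_liminf h, eventually_ne_atTop 0] with n h1 h2
  rwa [coe_lt_rpow_one_div_iff h2] at h1

theorem frequently_lt_pow_of_liminf_rpow_lt {u : ℕ → ℝ≥0∞} {t : ℝ≥0∞}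
    (h : liminf (fun n : ℕ => u n ^ (1 / (n : ℝ))) atTop < t) : ∃ᶠ n in atTop, u n < t ^ n := by
  refine ((frequently_lt_of_liminf_lt (by isBoundedDefault) h).and_eventually
    (eventually_ne_atTop 0)).mono ?_
  rintro n ⟨h1, h2⟩
  rwa [rpow_one_div_lt_coe_iff h2] at h1

/-! ### Growth of `β` in both directions -/

section ShiftBeta

variable {ω : ℤ → ℝ}

theorem shiftBeta_pos (h : ∀ n, 0 < ω n) (n : ℤ) : 0 < shiftBeta ω n := by
  unfold shiftBeta
  split_ifs
  · exact Finset.prod_pos fun i _ => h i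
  · exact inv_pos.2 (Finset.prod_pos fun i _ => h i)

theorem shiftBeta_add_one (h : ∀ n, 0 < ω n) (n : ℤ) :
    shiftBeta ω (n + 1) = ω n * shiftBeta ω n := by
  unfold shiftBeta
  rcases lt_trichotomy n (-1) with hn | rfl | hn
  · rw [if_neg (by omega), if_neg (by omega)]
    have : Finset.Ico n 0 = insert n (Finset.Ico (n + 1) 0) := by
      ext; simp; omega
    rw [this, Finset.prod_insert (by simp)]
    have := (h n).ne'
    field_simp
  · have : Finset.Ico (-1 : ℤ) 0 = {-1} := by ext; simp; omega
    simp [this, (h (-1)).ne']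
  · rw [if_pos (by omega), if_pos (by omega)]
    have : Finset.Ico 0 (n + 1) = insert n (Finset.Ico 0 n) := by
      ext; simp; omega
    rw [this, Finset.prod_insert (by simp)]

/-- Comparison with the geometric series of ratio `s / t`, for some `s` strictly between `r_3^+` and
`t`. -/
theorem summable_shiftBeta_div_pow {t : NNReal} (h : rThreePlus ω < t) (hω : ∀ n, 0 < ω n) :
    Summable fun n : ℕ => shiftBeta ω n / (t : ℝ) ^ n := by
  obtain ⟨s, hs, hst⟩ := ENNReal.lt_iff_exists_nnreal_btwn.1 h
  have hst : (s : ℝ) < t := by exact_mod_cast hst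
  have ht : (0 : ℝ) < t := s.coe_nonneg.trans_lt hst
  have hgeo : Summable fun n : ℕ => ((s : ℝ) / t) ^ n :=
    summable_geometric_of_lt_one (by positivity) ((div_lt_one ht).2 hst)
  refine hgeo.of_norm_bounded_eventually_nat ?_
  filter_upwards [eventually_lt_pow_of_limsup_rpow_lt hs] with n hn
  have hn' : shiftBeta ω n < (s : ℝ) ^ n := by
    rw [← ENNReal.ofReal_coe_nnreal, ← ENNReal.ofReal_pow s.coe_nonneg] at hn
    exact ((ENNReal.ofReal_lt_ofReal_iff_of_nonneg (shiftBeta_pos hω _).le).1 hn)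
  rw [Real.norm_of_nonneg (div_nonneg (shiftBeta_pos hω _).le (by positivity)), div_pow]
  gcongr

theorem summable_shiftBeta_neg_mul_pow {t : NNReal} (h : t < rTwoMinus ω) (hω : ∀ n, 0 < ω n) :
    Summable fun n : ℕ => shiftBeta ω (-n) * (t : ℝ) ^ n := by
  obtain ⟨s, hst, hs⟩ := ENNReal.lt_iff_exists_nnreal_btwn.1 h
  have hst : (t : ℝ) < s := by exact_mod_cast hst
  have hs0 : (0 : ℝ) < s := t.coe_nonneg.trans_lt hst
  have hgeo : Summable fun n : ℕ => ((t : ℝ) / s) ^ n :=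
    summable_geometric_of_lt_one (by positivity) ((div_lt_one hs0).2 hst)
  refine hgeo.of_norm_bounded_eventually_nat ?_
  filter_upwards [eventually_pow_lt_of_lt_liminf_rpow hs] with n hn
  have hβ := shiftBeta_pos hω (-n)
  have hn' : (s : ℝ) ^ n < 1 / shiftBeta ω (-n) := by
    rw [← ENNReal.ofReal_coe_nnreal, ← ENNReal.ofReal_pow s.coe_nonneg] at hn
    exact ((ENNReal.ofReal_lt_ofReal_iff_of_nonneg (by positivity)).1 hn)
  rw [Real.norm_of_nonneg (by positivity), div_pow, le_div_iff₀ (by positivity)]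
  rw [lt_div_iff₀ hβ] at hn'
  have : 0 < (t : ℝ) ^ n ∨ 0 = (t : ℝ) ^ n := (pow_nonneg t.coe_nonneg n).lt_or_eq
  nlinarith [pow_nonneg t.coe_nonneg n]

theorem frequently_pow_le_shiftBeta {t : NNReal} (h : t < rThreePlus ω) :
    ∃ᶠ n : ℕ in atTop, (t : ℝ) ^ n ≤ shiftBeta ω n := by
  refine (frequently_pow_lt_of_lt_limsup_rpow h).mono fun n hn => ?_
  rw [← ENNReal.ofReal_coe_nnreal, ← ENNReal.ofReal_pow t.coe_nonneg] at hn
  exact ((ENNReal.ofReal_lt_ofReal_iff_of_nonneg (by positivity)).1 hn).le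

theorem frequently_one_le_shiftBeta_neg_mul_pow {t : NNReal} (h : rTwoMinus ω < t)
    (hω : ∀ n, 0 < ω n) :
    ∃ᶠ n : ℕ in atTop, 1 ≤ shiftBeta ω (-n) * (t : ℝ) ^ n := by
  refine (frequently_lt_pow_of_liminf_rpow_lt h).mono fun n hn => ?_
  have hβ := shiftBeta_pos hω (-n)
  rw [← ENNReal.ofReal_coe_nnreal, ← ENNReal.ofReal_pow t.coe_nonneg,
    ENNReal.ofReal_lt_ofReal_iff_of_nonneg (by positivity), div_lt_iff₀ hβ] at hn
  linarith

end ShiftBeta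

/-- An eventual bound of a sequence by a positive sequence becomes global after scaling. -/
theorem exists_forall_le_mul_of_eventually_le {u v : ℕ → ℝ} (hv : ∀ n, 0 < v n)
    (h : ∀ᶠ n in atTop, u n ≤ v n) : ∃ C, ∀ n, u n ≤ C * v n := by
  have : IsBoundedUnder (· ≤ ·) atTop fun n => u n / v n :=
    ⟨1, eventually_map.2 (h.mono fun n hn => (div_le_one (hv n)).2 hn)⟩
  obtain ⟨C, hC⟩ := this.bddAbove_range
  exact ⟨C, fun n => (div_le_iff₀ (hv n)).1 (hC ⟨n, rfl⟩)⟩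

/-! ### Cauchy estimates for the normalised coefficients -/

section Coefficients

variable {H : Type*} [NormedAddCommGroup H] [InnerProductSpace ℂ H]

/-- The coefficients `a_n / β_n` of the Laurent series attached to `x = ∑ a_n e_n`. -/
noncomputable def laurentCoeff (e : HilbertBasis ℤ ℂ H) (ω : ℤ → ℝ) (x : H) (n : ℤ) : ℂ :=
  e.repr x n / (shiftBeta ω n : ℂ)

variable {e : HilbertBasis ℤ ℂ H} {ω : ℤ → ℝ} {x : H}

theorem norm_laurentCoeff (hω : ∀ n, 0 < ω n) (n : ℤ) :
    ‖laurentCoeff e ω x n‖ = ‖e.repr x n‖ / shiftBeta ω n := by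
  rw [laurentCoeff, norm_div, Complex.norm_of_nonneg (shiftBeta_pos hω n).le]

theorem exists_norm_laurentCoeff_neg_le (hω : ∀ n, 0 < ω n) {t : NNReal}
    (h : RMinus e ω x < t) : ∃ C, ∀ n : ℕ, ‖laurentCoeff e ω x (-n)‖ ≤ C * (t : ℝ) ^ n := by
  have ht : (0 : ℝ) < t := by exact_mod_cast (zero_le : 0 ≤ RMinus e ω x).trans_lt h
  refine exists_forall_le_mul_of_eventually_le (fun n => by positivity) ?_
  filter_upwards [eventually_lt_pow_of_limsup_rpow_lt h] with n hn
  have hβ := shiftBeta_pos hω (-n)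
  rw [← ofReal_norm, ← ENNReal.ofReal_div_of_pos hβ, ← ENNReal.ofReal_coe_nnreal,
    ← ENNReal.ofReal_pow t.coe_nonneg, ENNReal.ofReal_lt_ofReal_iff_of_nonneg (by positivity)] at hn
  rw [norm_laurentCoeff hω]
  exact hn.le

theorem exists_norm_laurentCoeff_le_inv (hω : ∀ n, 0 < ω n) {t : NNReal} (ht : 0 < t)
    (h : t < RPlus e ω x) : ∃ C, ∀ n : ℕ, ‖laurentCoeff e ω x n‖ ≤ C * ((t : ℝ) ^ n)⁻¹ := by
  have ht : (0 : ℝ) < t := by exact_mod_cast ht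
  refine exists_forall_le_mul_of_eventually_le (fun n => by positivity) ?_
  filter_upwards [eventually_pow_lt_of_lt_liminf_rpow h] with n hn
  have hβ := shiftBeta_pos hω n
  rw [norm_laurentCoeff hω]
  -- A zero coefficient makes the quotient `+∞`, which cannot be inverted in the reals; the bound is
  -- then trivial.
  by_cases ha : e.repr x n = 0
  · simp only [ha, norm_zero, zero_div]; positivity
  have ha := norm_pos_iff.2 ha
  rw [← ofReal_norm, ← ENNReal.ofReal_div_of_pos ha, ← ENNReal.ofReal_coe_nnreal,
    ← ENNReal.ofReal_pow t.coe_nonneg, ENNReal.ofReal_lt_ofReal_iff_of_nonneg (by positivity)] at hn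
  rw [← inv_div]
  exact inv_anti₀ (by positivity) hn.le

/-- A Cauchy estimate at a radius inside the annulus of convergence: `RMinus` governs the negative
indices, `RPlus` the others. Using it at two radii gives the decay needed on both sides. -/
theorem exists_norm_laurentCoeff_le (hω : ∀ n, 0 < ω n) {t : NNReal}
    (h1 : RMinus e ω x < t) (h2 : t < RPlus e ω x) :
    ∃ C, ∀ n : ℤ, ‖laurentCoeff e ω x n‖ ≤ C * (t : ℝ) ^ (-n) := by
  have ht : 0 < t := by exact_mod_cast (zero_le : 0 ≤ RMinus e ω x).trans_lt h1
  obtain ⟨C, hC⟩ := exists_norm_laurentCoeff_neg_le hω h1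
  obtain ⟨D, hD⟩ := exists_norm_laurentCoeff_le_inv hω ht h2
  have ht : (0 : ℝ) < t := by exact_mod_cast ht
  refine ⟨max C D, fun n => ?_⟩
  obtain ⟨k, rfl | rfl⟩ := n.eq_nat_or_neg
  · refine (hD k).trans ?_
    rw [zpow_neg, zpow_natCast]
    gcongr
    exact le_max_right _ _
  · refine (hC k).trans ?_
    rw [neg_neg, zpow_natCast]
    gcongr
    exact le_max_left _ _

end Coefficients

/-! ### Tails and heads of Laurent series -/

/-- The analytic part `∑_{m > n} c_m λ^{m-n-1}` of a Laurent series, cut at degree `n`. -/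
noncomputable def laurentTail (c : ℤ → ℂ) (n : ℤ) (z : ℂ) : ℂ :=
  ∑' j : ℕ, c (n + 1 + j) * z ^ j

/-- The principal part `∑_{m ≤ n} c_m λ^{m-n-1}` of a Laurent series, cut at degree `n`. -/
noncomputable def laurentHead (c : ℤ → ℂ) (n : ℤ) (z : ℂ) : ℂ :=
  ∑' j : ℕ, c (n - j) * (z ^ (j + 1))⁻¹

section Laurent

variable {c : ℤ → ℂ} {C t q : ℝ}

theorem norm_laurentTail_term_le (ht : 0 < t) (hc : ∀ m, ‖c m‖ ≤ C * t ^ (-m)) (n : ℤ) {z : ℂ}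
    (hz : ‖z‖ ≤ q) (j : ℕ) :
    ‖c (n + 1 + j) * z ^ j‖ ≤ C * t ^ (-(n + 1)) * (q / t) ^ j := by
  calc ‖c (n + 1 + j) * z ^ j‖ ≤ (C * t ^ (-(n + 1 + (j : ℤ)))) * q ^ j := by
        rw [norm_mul, norm_pow]
        gcongr
        · exact (norm_nonneg _).trans (hc (n + 1 + j))
        · exact hc _
    _ = C * t ^ (-(n + 1)) * (q / t) ^ j := by
        rw [neg_add, zpow_add₀ ht.ne', zpow_neg t j, zpow_natCast, div_pow]
        ring

theorem norm_laurentHead_term_le (ht : 0 < t) (hq : 0 < q) (hc : ∀ m, ‖c m‖ ≤ C * t ^ (-m))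
    (n : ℤ) {z : ℂ} (hz : q ≤ ‖z‖) (j : ℕ) :
    ‖c (n - j) * (z ^ (j + 1))⁻¹‖ ≤ C * t ^ (-n) * q⁻¹ * (t / q) ^ j := by
  calc ‖c (n - j) * (z ^ (j + 1))⁻¹‖ ≤ (C * t ^ (-(n - (j : ℤ)))) * (q ^ (j + 1))⁻¹ := by
        rw [norm_mul, norm_inv, norm_pow]
        gcongr
        · exact (norm_nonneg _).trans (hc (n - j))
        · exact hc _
    _ = C * t ^ (-n) * q⁻¹ * (t / q) ^ j := by
        rw [neg_sub', sub_neg_eq_add, zpow_add₀ ht.ne', zpow_natCast, div_pow, pow_succ]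
        field_simp

theorem summable_laurentTail_bound (hq : 0 ≤ q) (hqt : q < t) (K : ℝ) :
    Summable fun j : ℕ => K * (q / t) ^ j :=
  (summable_geometric_of_lt_one (div_nonneg hq (hq.trans hqt.le))
    ((div_lt_one (hq.trans_lt hqt)).2 hqt)).mul_left _

theorem summable_laurentTail (hq : 0 ≤ q) (hqt : q < t) (hc : ∀ m, ‖c m‖ ≤ C * t ^ (-m)) (n : ℤ)
    {z : ℂ} (hz : ‖z‖ ≤ q) : Summable fun j : ℕ => c (n + 1 + j) * z ^ j :=
  (summable_laurentTail_bound hq hqt _).of_norm_bounded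
    (norm_laurentTail_term_le (hq.trans_lt hqt) hc n hz)

theorem norm_laurentTail_le (hq : 0 ≤ q) (hqt : q < t) (hc : ∀ m, ‖c m‖ ≤ C * t ^ (-m)) (n : ℤ)
    {z : ℂ} (hz : ‖z‖ ≤ q) : ‖laurentTail c n z‖ ≤ C * t⁻¹ * (1 - q / t)⁻¹ * t ^ (-n) := by
  have ht := hq.trans_lt hqt
  refine (tsum_of_norm_bounded ((hasSum_geometric_of_lt_one (div_nonneg hq ht.le)
    ((div_lt_one ht).2 hqt)).mul_left _) (norm_laurentTail_term_le ht hc n hz)).trans_eq ?_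
  rw [neg_add, zpow_add₀ ht.ne', zpow_neg_one]
  ring

theorem differentiableOn_laurentTail (hq : 0 ≤ q) (hqt : q < t)
    (hc : ∀ m, ‖c m‖ ≤ C * t ^ (-m)) (n : ℤ) :
    DifferentiableOn ℂ (laurentTail c n) (Metric.ball 0 q) := by
  refine Complex.differentiableOn_tsum_of_summable_norm (summable_laurentTail_bound hq hqt _)
    (fun j => by fun_prop) Metric.isOpen_ball fun j z hz =>
      norm_laurentTail_term_le (hq.trans_lt hqt) hc n ?_ j
  exact (mem_ball_zero_iff.1 hz).le

theorem summable_laurentHead (ht : 0 < t) (htq : t < q) (hc : ∀ m, ‖c m‖ ≤ C * t ^ (-m)) (n : ℤ)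
    {z : ℂ} (hz : q ≤ ‖z‖) : Summable fun j : ℕ => c (n - j) * (z ^ (j + 1))⁻¹ :=
  (summable_laurentTail_bound ht.le htq _).of_norm_bounded
    (norm_laurentHead_term_le ht (ht.trans htq) hc n hz)

theorem norm_laurentHead_le (ht : 0 < t) (htq : t < q) (hc : ∀ m, ‖c m‖ ≤ C * t ^ (-m)) (n : ℤ)
    {z : ℂ} (hz : q ≤ ‖z‖) : ‖laurentHead c n z‖ ≤ C * q⁻¹ * (1 - t / q)⁻¹ * t ^ (-n) := by
  have hq := ht.trans htq
  refine (tsum_of_norm_bounded ((hasSum_geometric_of_lt_one (div_nonneg ht.le hq.le)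
    ((div_lt_one hq).2 htq)).mul_left _) (norm_laurentHead_term_le ht hq hc n hz)).trans_eq ?_
  ring

theorem isOpen_lt_norm (q : ℝ) : IsOpen {z : ℂ | q < ‖z‖} := isOpen_lt continuous_const continuous_norm

theorem differentiableOn_laurentHead (ht : 0 < t) (htq : t < q)
    (hc : ∀ m, ‖c m‖ ≤ C * t ^ (-m)) (n : ℤ) :
    DifferentiableOn ℂ (laurentHead c n) {z : ℂ | q < ‖z‖} := by
  refine Complex.differentiableOn_tsum_of_summable_norm (summable_laurentTail_bound ht.le htq _)
    (fun j => ?_) (isOpen_lt_norm q) fun j z hz =>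
      norm_laurentHead_term_le ht (ht.trans htq) hc n (le_of_lt hz) j
  refine DifferentiableOn.const_mul (DifferentiableOn.inv (by fun_prop) fun z hz => ?_) _
  exact pow_ne_zero _ (norm_pos_iff.1 ((ht.trans htq).trans hz))

theorem laurentTail_sub_one (hq : 0 ≤ q) (hqt : q < t) (hc : ∀ m, ‖c m‖ ≤ C * t ^ (-m)) (n : ℤ)
    {z : ℂ} (hz : ‖z‖ ≤ q) : laurentTail c (n - 1) z = c n + z * laurentTail c n z := by
  have h := summable_laurentTail hq hqt hc (n - 1) hz
  rw [laurentTail, h.tsum_eq_zero_add, laurentTail, ← tsum_mul_left]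
  congr 1
  · simp
  · refine tsum_congr fun j => ?_
    rw [show n - 1 + 1 + ((j + 1 : ℕ) : ℤ) = n + 1 + j by push_cast; ring, pow_succ]
    ring

theorem mul_laurentHead (ht : 0 < t) (htq : t < q) (hc : ∀ m, ‖c m‖ ≤ C * t ^ (-m)) (n : ℤ)
    {z : ℂ} (hz : q ≤ ‖z‖) : z * laurentHead c n z = c n + laurentHead c (n - 1) z := by
  have hz0 : z ≠ 0 := norm_pos_iff.1 ((ht.trans htq).trans_le hz)
  have h := summable_laurentHead ht htq hc n hz
  rw [laurentHead, h.tsum_eq_zero_add, laurentHead, mul_add, ← tsum_mul_left]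
  congr 1
  · simp; field_simp
  · refine tsum_congr fun j => ?_
    rw [show n - ((j + 1 : ℕ) : ℤ) = n - 1 - j by push_cast; ring, pow_succ z (j + 1)]
    field_simp

/-- Cutting at degree `0` puts index `k ≥ 0` in the tail and `k ≤ -1` in the head; the shift `k + 1`
reflects that the sum is the Laurent series divided by `z`. -/
theorem hasSum_laurent {s : ℝ} (ht : 0 < t) (htq : t < s) (hc : ∀ m, ‖c m‖ ≤ C * t ^ (-m))
    {D q : ℝ} (hsq : s < q) (hd : ∀ m, ‖c m‖ ≤ D * q ^ (-m)) {z : ℂ} (hz : ‖z‖ = s) :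
    HasSum (fun k : ℤ => c (k + 1) * z ^ k) (laurentTail c 0 z + laurentHead c 0 z) := by
  refine HasSum.of_nat_of_neg_add_one ?_ ?_
  · convert (summable_laurentTail (ht.trans htq).le hsq hd 0 hz.le).hasSum using 2 with j
    · rw [zpow_natCast]
      ring_nf
    · rfl
  · convert (summable_laurentHead ht htq hc 0 hz.ge).hasSum using 2 with j
    · rw [zpow_neg, show (j : ℤ) + 1 = ((j + 1 : ℕ) : ℤ) by push_cast; ring, zpow_natCast]
      congr 2
      push_cast; ring
    · rfl

end Laurent

/-! ### Uniqueness of Laurent expansions -/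

/-- An absolutely convergent trigonometric series with sum zero has zero coefficients. -/
theorem eq_zero_of_hasSum_exp {b : ℤ → ℂ} (hb : Summable fun n => ‖b n‖)
    (h : ∀ θ : ℝ, HasSum (fun n : ℤ => b n * Complex.exp (n * (θ * Complex.I))) 0) : b = 0 := by
  have : Fact (0 < 2 * Real.pi) := ⟨Real.two_pi_pos⟩
  have hs : Summable fun n : ℤ => b n • (fourier n : C(AddCircle (2 * Real.pi), ℂ)) := by
    refine Summable.of_norm_bounded hb fun n => ?_
    rw [norm_smul, fourier_norm, mul_one]
  -- The series converges uniformly, so its sum in `C(AddCircle, ℂ)` can be identified by evaluating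
  -- at points.
  have h0 : HasSum (fun n : ℤ => b n • (fourier n : C(AddCircle (2 * Real.pi), ℂ))) 0 := by
    convert hs.hasSum
    ext y
    induction y using QuotientAddGroup.induction_on with
    | H θ =>
      refine (h θ).unique ?_
      convert hs.hasSum.mapL (ContinuousMap.evalCLM ℂ (θ : AddCircle (2 * Real.pi))) using 2 with n
      · have : (Real.pi : ℂ) ≠ 0 := by exact_mod_cast Real.pi_ne_zero
        simp only [ContinuousMap.evalCLM_apply, ContinuousMap.smul_apply, smul_eq_mul]
        rw [fourier_coe_apply]
        congr 2
        push_cast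
        field_simp
      · rfl
  funext k
  -- Pairing with the `k`-th character in `L²` isolates the coefficient `b k`.
  have h1 := (h0.mapL (ContinuousMap.toLp 2 AddCircle.haarAddCircle ℂ)).mapL
    (innerSL ℂ (fourierLp (T := 2 * Real.pi) 2 k))
  have h2 := (orthonormal_iff_ite.1 (orthonormal_fourier (T := 2 * Real.pi))) k
  have h3 : (fun n => innerSL ℂ (fourierLp (T := 2 * Real.pi) 2 k)
      (ContinuousMap.toLp 2 AddCircle.haarAddCircle ℂ (b n • fourier n))) =
      fun n => if n = k then b k else 0 := by
    funext n
    rw [map_smul, map_smul, innerSL_apply_apply, h2 n]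
    by_cases hk : n = k
    · simp [hk]
    · simp [hk, Ne.symm hk]
  rw [h3, map_zero, map_zero] at h1
  exact (hasSum_ite_eq k (b k)).unique h1

theorem isPreconnected_annulus {p q : ℝ} (hp : 0 ≤ p) :
    IsPreconnected {z : ℂ | p < ‖z‖ ∧ ‖z‖ < q} := by
  have : {z : ℂ | p < ‖z‖ ∧ ‖z‖ < q} =
      (fun w : ℝ × ℝ => circleMap 0 w.1 w.2) '' (Set.Ioo p q ×ˢ Set.univ) := by
    ext z
    simp only [Set.mem_ofPred_eq, Set.mem_image, Set.mem_prod, Set.mem_Ioo, Set.mem_univ, and_true,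
      Prod.exists]
    constructor
    · intro h
      exact ⟨‖z‖, z.arg, h, by simp [circleMap]⟩
    · rintro ⟨r, θ, h, rfl⟩
      simpa [circleMap, abs_of_pos (hp.trans_lt h.1)] using h
  rw [this]
  refine (isPreconnected_Ioo.prod isPreconnected_univ).image _ ?_
  unfold circleMap
  fun_prop

/-- A Laurent series that vanishes near a point of its open annulus of convergence is zero. -/
theorem laurent_coeff_eq_zero {c : ℤ → ℂ} {C D t q : ℝ} (ht : 0 < t)
    (hc : ∀ m, ‖c m‖ ≤ C * t ^ (-m)) (hd : ∀ m, ‖c m‖ ≤ D * q ^ (-m)) {z₀ : ℂ}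
    (h1 : t < ‖z₀‖) (h2 : ‖z₀‖ < q)
    (h : ∀ᶠ z in nhds z₀, laurentTail c 0 z + laurentHead c 0 z = 0) : c = 0 := by
  obtain ⟨t', ht1, ht2⟩ := exists_between h1
  obtain ⟨q', hq1, hq2⟩ := exists_between h2
  have hU : IsOpen {z : ℂ | t' < ‖z‖ ∧ ‖z‖ < q'} :=
    (isOpen_lt_norm t').inter (isOpen_lt continuous_norm continuous_const)
  have hq' : 0 < q' := (norm_nonneg _).trans_lt hq1
  have hT := ((differentiableOn_laurentTail hq'.le hq2 hd 0).mono
    (t := Metric.ball 0 q') (s := {z : ℂ | t' < ‖z‖ ∧ ‖z‖ < q'})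
    fun z hz => mem_ball_zero_iff.2 hz.2)
  have hH := ((differentiableOn_laurentHead ht ht1 hc 0).mono
    (s := {z : ℂ | t' < ‖z‖ ∧ ‖z‖ < q'}) fun z hz => hz.1)
  -- The annulus is connected, so vanishing near `z₀` spreads to the whole circle through `z₀`,
  -- where Fourier uniqueness applies.
  have hE := ((hT.add hH).analyticOnNhd hU).eqOn_of_preconnected_of_eventuallyEq
    (g := 0) (fun _ _ => analyticAt_const) (isPreconnected_annulus (ht.trans ht1).le)
    ⟨ht2, hq1⟩ h
  have hz₀ : 0 < ‖z₀‖ := ht.trans h1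
  have hsum := fun (z : ℂ) (hz : ‖z‖ = ‖z₀‖) => hasSum_laurent ht h1 hc h2 hd hz
  have key : (fun k : ℤ => c (k + 1) * (‖z₀‖ : ℂ) ^ k) = 0 := by
    refine eq_zero_of_hasSum_exp ?_ fun θ => ?_
    · exact (hsum (‖z₀‖ : ℂ) (by simp)).summable.norm
    · have hn : ‖(‖z₀‖ : ℂ) * Complex.exp (θ * Complex.I)‖ = ‖z₀‖ := by
        rw [norm_mul, Complex.norm_exp_ofReal_mul_I]; simp
      have := hsum _ hn
      rw [show laurentTail c 0 _ + laurentHead c 0 _ = 0 from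
        hE (show _ ∧ _ by rw [hn]; exact ⟨ht2, hq1⟩)] at this
      convert this using 2 with k
      rw [mul_zpow, ← Complex.exp_int_mul, mul_assoc]
  funext m
  have hm : c m * (‖z₀‖ : ℂ) ^ (m - 1) = 0 := by simpa using congrFun key (m - 1)
  exact (mul_eq_zero.1 hm).resolve_right (zpow_ne_zero _ (by exact_mod_cast hz₀.ne'))

/-! ### Solving the resolvent equation in coordinates -/

section Shift

variable {H : Type*} [NormedAddCommGroup H] [InnerProductSpace ℂ H]
  {S : H →L[ℂ] H} {e : HilbertBasis ℤ ℂ H} {ω : ℤ → ℝ} {x : H}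

theorem IsBilateralWeightedShift.hasSum_apply (hS : IsBilateralWeightedShift S e ω)
    {a : ℤ → ℂ} {y : H} (h : HasSum (fun n => a n • e n) y) :
    HasSum (fun n => ((ω (n - 1) : ℂ) * a (n - 1)) • e n) (S y) := by
  refine (Equiv.addRight (1 : ℤ)).hasSum_iff.1 ?_
  convert h.mapL S using 2 with n
  simp only [Function.comp_apply, Equiv.coe_addRight, add_sub_cancel_right]
  rw [map_smul, hS.apply_basis, smul_smul, mul_comm]

theorem HilbertBasis.repr_eq_of_hasSum (e : HilbertBasis ℤ ℂ H) {a : ℤ → ℂ} {y : H}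
    (h : HasSum (fun n => a n • e n) y) (k : ℤ) : e.repr y k = a k := by
  rw [HilbertBasis.repr_apply_apply]
  have h1 := h.mapL (innerSL ℂ (e k))
  have h2 : (fun n => innerSL ℂ (e k) (a n • e n)) = fun n => if n = k then a k else 0 := by
    funext n
    rw [map_smul, innerSL_apply_apply, orthonormal_iff_ite.1 e.orthonormal k n]
    by_cases hk : n = k
    · simp [hk]
    · simp [hk, Ne.symm hk]
  rw [h2] at h1
  exact h1.unique (hasSum_ite_eq k (a k))

theorem IsBilateralWeightedShift.repr_apply (hS : IsBilateralWeightedShift S e ω) (y : H) (n : ℤ) :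
    e.repr (S y) n = ω (n - 1) * e.repr y (n - 1) :=
  e.repr_eq_of_hasSum (hS.hasSum_apply (e.hasSum_repr y)) n

/-- A summable family of holomorphic coefficient functions solving the recurrence equivalent to
`(S - λ) f(λ) = x` on an open set yields a local resolvent function. -/
theorem IsBilateralWeightedShift.subset_localResolventSet [CompleteSpace H]
    (hS : IsBilateralWeightedShift S e ω) {U : Set ℂ} (hU : IsOpen U) {φ : ℤ → ℂ → ℂ}
    {M : ℤ → ℝ} (hM : Summable M) (hφ : ∀ n, DifferentiableOn ℂ (φ n) U)
    (hle : ∀ n, ∀ z ∈ U, ‖φ n z‖ ≤ M n)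
    (hrec : ∀ n, ∀ z ∈ U, ω (n - 1) * φ (n - 1) z - z * φ n z = e.repr x n) :
    U ⊆ localResolventSet S x := by
  have hle' : ∀ n, ∀ z ∈ U, ‖φ n z • e n‖ ≤ M n := fun n z hz => by
    rw [norm_smul, e.orthonormal.1 n, mul_one]
    exact hle n z hz
  refine Set.subset_sUnion_of_mem ⟨hU, fun z => ∑' n, φ n z • e n, ?_, fun z hz => ?_⟩
  · exact (Complex.differentiableOn_tsum_of_summable_norm hM
      (fun n => (hφ n).smul_const (e n)) hU hle').analyticOnNhd hU
  · have h := (hM.of_norm_bounded (hle' · z hz)).hasSum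
    refine ((hS.hasSum_apply h).sub (h.const_smul z)).unique ?_
    convert e.hasSum_repr x using 2 with n
    rw [smul_smul, ← sub_smul, hrec n z hz]

theorem shiftBeta_mul_laurentCoeff (hω : ∀ n, 0 < ω n) (n : ℤ) :
    (shiftBeta ω n : ℂ) * laurentCoeff e ω x n = e.repr x n := by
  have : (shiftBeta ω n : ℂ) ≠ 0 := by exact_mod_cast (shiftBeta_pos hω n).ne'
  rw [laurentCoeff]
  field_simp

theorem weight_mul_shiftBeta (hω : ∀ n, 0 < ω n) (n : ℤ) :
    (ω (n - 1) : ℂ) * (shiftBeta ω (n - 1) : ℂ) = shiftBeta ω n := by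
  have := shiftBeta_add_one hω (n - 1)
  rw [sub_add_cancel] at this
  rw [this]
  push_cast
  ring

/-- The bound at radius `s` gives summability as `n → -∞` and the one at radius `t` as `n → +∞`. The
minimum keeps a single majorant. -/
theorem summable_shiftBeta_mul_min (hω : ∀ n, 0 < ω n) {s t : NNReal} {A B : ℝ}
    (hA : 0 ≤ A) (hB : 0 ≤ B) (hs : s < rTwoMinus ω) (ht : rThreePlus ω < t) :
    Summable fun n : ℤ => shiftBeta ω n * min (A * (s : ℝ) ^ (-n)) (B * (t : ℝ) ^ (-n)) := by
  have h0 : ∀ n : ℤ, 0 ≤ shiftBeta ω n * min (A * (s : ℝ) ^ (-n)) (B * (t : ℝ) ^ (-n)) :=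
    fun n => mul_nonneg (shiftBeta_pos hω n).le (le_min (by positivity) (by positivity))
  refine Summable.of_nat_of_neg ?_ ?_
  · refine ((summable_shiftBeta_div_pow ht hω).mul_left B).of_nonneg_of_le (fun n => h0 n)
      fun n => ?_
    refine (mul_le_mul_of_nonneg_left (min_le_right _ _) (shiftBeta_pos hω n).le).trans_eq ?_
    rw [zpow_neg, zpow_natCast]
    ring
  · refine ((summable_shiftBeta_neg_mul_pow hs hω).mul_left A).of_nonneg_of_le (fun n => h0 (-n))
      fun n => ?_
    refine (mul_le_mul_of_nonneg_left (min_le_left _ _) (shiftBeta_pos hω (-n)).le).trans_eq ?_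
    rw [neg_neg, zpow_natCast]
    ring

/-- The tails, multiplied by `β_n`, form an explicit solution, holomorphic on the whole disc. -/
theorem IsBilateralWeightedShift.ball_subset_localResolventSet [CompleteSpace H]
    (hS : IsBilateralWeightedShift S e ω) (hr : rTwoMinus ω ≤ rThreePlus ω)
    (h1 : RMinus e ω x < rTwoMinus ω) (h2 : rThreePlus ω < RPlus e ω x) {q : NNReal}
    (hq : q < rTwoMinus ω) : Metric.ball (0 : ℂ) q ⊆ localResolventSet S x := by
  have hω := hS.weight_pos
  -- The radius `s` exceeds `R_ω^-(x)` for the Cauchy estimate and `q` for convergence of the tails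
  -- on the disc, yet stays below `r_2^-` for summability.
  obtain ⟨s, hs1, hs2⟩ := ENNReal.lt_iff_exists_nnreal_btwn.1 (max_lt h1 hq)
  obtain ⟨t, ht1, ht2⟩ := ENNReal.lt_iff_exists_nnreal_btwn.1 h2
  have hqs : q < s := by exact_mod_cast (le_max_right _ _).trans_lt hs1
  have hst : s < t := by exact_mod_cast (hs2.trans_le hr).trans ht1
  obtain ⟨C, hC⟩ := exists_norm_laurentCoeff_le (x := x) hω ((le_max_left _ _).trans_lt hs1)
    (hs2.trans_le (hr.trans h2.le))
  obtain ⟨D, hD⟩ := exists_norm_laurentCoeff_le (x := x) hω (h1.trans_le (hr.trans ht1.le)) ht2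
  have hqt : (q : ℝ) < t := by exact_mod_cast hqs.trans hst
  have hqs : (q : ℝ) < s := by exact_mod_cast hqs
  have hq0 := q.coe_nonneg
  have hC0 : 0 ≤ C := by simpa using (norm_nonneg _).trans (hC 0)
  have hD0 : 0 ≤ D := by simpa using (norm_nonneg _).trans (hD 0)
  have hgs : 0 ≤ (1 - (q : ℝ) / s)⁻¹ :=
    inv_nonneg.2 (sub_nonneg.2 (div_le_one_of_le₀ hqs.le s.coe_nonneg))
  have hgt : 0 ≤ (1 - (q : ℝ) / t)⁻¹ :=
    inv_nonneg.2 (sub_nonneg.2 (div_le_one_of_le₀ hqt.le t.coe_nonneg))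
  refine hS.subset_localResolventSet Metric.isOpen_ball
    (φ := fun n z => shiftBeta ω n * laurentTail (laurentCoeff e ω x) n z)
    (summable_shiftBeta_mul_min hω (A := C * (s : ℝ)⁻¹ * (1 - (q : ℝ) / s)⁻¹)
      (B := D * (t : ℝ)⁻¹ * (1 - (q : ℝ) / t)⁻¹) (by positivity) (by positivity) hs2 ht1)
    (fun n => (differentiableOn_laurentTail hq0 hqs hC n).const_mul _) ?_ ?_
  · intro n z hz
    have hz := (mem_ball_zero_iff.1 hz).le
    rw [norm_mul, Complex.norm_of_nonneg (shiftBeta_pos hω n).le]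
    exact mul_le_mul_of_nonneg_left (le_min (norm_laurentTail_le hq0 hqs hC n hz)
      (norm_laurentTail_le hq0 hqt hD n hz)) (shiftBeta_pos hω n).le
  · intro n z hz
    have hz := (mem_ball_zero_iff.1 hz).le
    rw [← mul_assoc, weight_mul_shiftBeta hω, laurentTail_sub_one hq0 hqs hC n hz,
      ← shiftBeta_mul_laurentCoeff (x := x) (e := e) hω n]
    ring

/-- The counterpart outside the annulus: heads replace tails, with a minus sign because they solve
the recurrence with the opposite right-hand side. -/
theorem IsBilateralWeightedShift.lt_norm_subset_localResolventSet [CompleteSpace H]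
    (hS : IsBilateralWeightedShift S e ω) (hr : rTwoMinus ω ≤ rThreePlus ω)
    (h1 : RMinus e ω x < rTwoMinus ω) (h2 : rThreePlus ω < RPlus e ω x) {q : NNReal}
    (hq : rThreePlus ω < q) : {z : ℂ | q < ‖z‖} ⊆ localResolventSet S x := by
  have hω := hS.weight_pos
  obtain ⟨s, hs1, hs2⟩ := ENNReal.lt_iff_exists_nnreal_btwn.1 h1
  obtain ⟨t, ht1, ht2⟩ := ENNReal.lt_iff_exists_nnreal_btwn.1 (lt_min h2 hq)
  have htq : t < q := by exact_mod_cast ht2.trans_le (min_le_right _ _)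
  have hst : s < t := by exact_mod_cast (hs2.trans_le hr).trans ht1
  have hs0 : 0 < s := by exact_mod_cast (zero_le : 0 ≤ RMinus e ω x).trans_lt hs1
  obtain ⟨C, hC⟩ := exists_norm_laurentCoeff_le (x := x) hω hs1 (hs2.trans_le (hr.trans h2.le))
  obtain ⟨D, hD⟩ := exists_norm_laurentCoeff_le (x := x) hω (h1.trans_le (hr.trans ht1.le))
    (ht2.trans_le (min_le_left _ _))
  have hsq : (s : ℝ) < q := by exact_mod_cast hst.trans htq
  have htq : (t : ℝ) < q := by exact_mod_cast htq
  have ht0 : (0 : ℝ) < t := by exact_mod_cast hs0.trans hst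
  have hs0 : (0 : ℝ) < s := by exact_mod_cast hs0
  have hC0 : 0 ≤ C := by simpa using (norm_nonneg _).trans (hC 0)
  have hD0 : 0 ≤ D := by simpa using (norm_nonneg _).trans (hD 0)
  have hgs : 0 ≤ (1 - (s : ℝ) / q)⁻¹ :=
    inv_nonneg.2 (sub_nonneg.2 (div_le_one_of_le₀ hsq.le q.coe_nonneg))
  have hgt : 0 ≤ (1 - (t : ℝ) / q)⁻¹ :=
    inv_nonneg.2 (sub_nonneg.2 (div_le_one_of_le₀ htq.le q.coe_nonneg))
  refine hS.subset_localResolventSet (isOpen_lt_norm q)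
    (φ := fun n z => -shiftBeta ω n * laurentHead (laurentCoeff e ω x) n z)
    (summable_shiftBeta_mul_min hω (A := C * (q : ℝ)⁻¹ * (1 - (s : ℝ) / q)⁻¹)
      (B := D * (q : ℝ)⁻¹ * (1 - (t : ℝ) / q)⁻¹) (by positivity) (by positivity) hs2 ht1)
    (fun n => (differentiableOn_laurentHead hs0 hsq hC n).const_mul _) ?_ ?_
  · intro n z hz
    have hz : (q : ℝ) ≤ ‖z‖ := (show (q : ℝ) < ‖z‖ from hz).le
    rw [norm_mul, norm_neg, Complex.norm_of_nonneg (shiftBeta_pos hω n).le]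
    exact mul_le_mul_of_nonneg_left (le_min (norm_laurentHead_le hs0 hsq hC n hz)
      (norm_laurentHead_le ht0 htq hD n hz)) (shiftBeta_pos hω n).le
  · intro n z hz
    have hz : (q : ℝ) ≤ ‖z‖ := (show (q : ℝ) < ‖z‖ from hz).le
    have h := mul_laurentHead hs0 hsq hC n hz
    have hw := weight_mul_shiftBeta hω n
    rw [← shiftBeta_mul_laurentCoeff (x := x) (e := e) hω n]
    linear_combination (-laurentHead (laurentCoeff e ω x) (n - 1) z) * hw + shiftBeta ω n * h

/-! ### Forced values of the coordinate at `0` -/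

theorem HilbertBasis.tendsto_repr_comp_zero (e : HilbertBasis ℤ ℂ H) (y : H) {g : ℕ → ℤ}
    (hg : Function.Injective g) : Tendsto (fun n => e.repr y (g n)) atTop (nhds 0) := by
  have h := ((lp.memℓp (e.repr y)).summable (by norm_num)).comp_injective hg
  have h' := h.tendsto_atTop_zero
  simp only [Function.comp_def, ENNReal.toReal_ofNat, Real.rpow_ofNat] at h'
  rw [tendsto_zero_iff_norm_tendsto_zero]
  simpa using h'.sqrt

/-- A convergent sequence that is frequently dominated by a null sequence has limit zero. -/
theorem eq_zero_of_tendsto_of_frequently_norm_le {u v : ℕ → ℂ} {l : ℂ}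
    (hu : Tendsto u atTop (nhds l)) (hv : Tendsto v atTop (nhds 0))
    (h : ∃ᶠ n in atTop, ‖u n‖ ≤ ‖v n‖) : l = 0 := by
  have := le_of_tendsto_of_tendsto_of_frequently hu.norm hv.norm h
  simpa using this

/-- The Laurent-type normalisation of the coefficients of a solution of `(S - z) y = x`. -/
theorem IsBilateralWeightedShift.normalized_coeff_sub (hS : IsBilateralWeightedShift S e ω)
    {y : H} {z : ℂ} (hz : z ≠ 0) (hy : S y - z • y = x) (n : ℤ) :
    laurentCoeff e ω y (n - 1) * z ^ (n - 1) - laurentCoeff e ω y n * z ^ n =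
      laurentCoeff e ω x n * z ^ (n - 1) := by
  have hω := hS.weight_pos
  have h1 : ω (n - 1) * e.repr y (n - 1) - z * e.repr y n = e.repr x n := by
    rw [← hS.repr_apply, ← hy, map_sub, map_smul]
    rfl
  have hb := weight_mul_shiftBeta hω n
  have hn : (shiftBeta ω n : ℂ) ≠ 0 := by exact_mod_cast (shiftBeta_pos hω n).ne'
  rw [← shiftBeta_mul_laurentCoeff hω, ← shiftBeta_mul_laurentCoeff hω n,
    ← shiftBeta_mul_laurentCoeff hω n, ← mul_assoc, hb] at h1
  have h2 : laurentCoeff e ω y (n - 1) - z * laurentCoeff e ω y n = laurentCoeff e ω x n := by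
    refine mul_left_cancel₀ hn ?_
    linear_combination h1
  rw [← h2, show z ^ n = z ^ (n - 1) * z by rw [← zpow_add_one₀ hz, sub_add_cancel]]
  ring

theorem IsBilateralWeightedShift.repr_zero_eq_laurentTail (hS : IsBilateralWeightedShift S e ω)
    {y : H} {z : ℂ} (hz : z ≠ 0) (hy : S y - z • y = x) (h3 : ‖z‖ₑ < rThreePlus ω)
    (hs : Summable fun j : ℕ => laurentCoeff e ω x (0 + 1 + j) * z ^ j) :
    e.repr y 0 = laurentTail (laurentCoeff e ω x) 0 z := by
  have hω := hS.weight_pos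
  -- The normalised recurrence telescopes; `β_0 = 1` identifies the initial term with `e.repr y 0`.
  have hsum : ∀ N : ℕ, ∑ j ∈ Finset.range N, laurentCoeff e ω x (0 + 1 + j) * z ^ j =
      e.repr y 0 - laurentCoeff e ω y N * z ^ N := by
    intro N
    induction N with
    | zero => simp [laurentCoeff, shiftBeta]
    | succ N ih =>
      have := hS.normalized_coeff_sub hz hy (N + 1)
      rw [add_sub_cancel_right] at this
      norm_cast at this
      rw [Finset.sum_range_succ, ih, zero_add, add_comm 1 (N : ℤ)]
      push_cast at this ⊢
      rw [← this]
      ring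
  have ht : Tendsto _ atTop (nhds (laurentTail (laurentCoeff e ω x) 0 z)) :=
    hs.hasSum.tendsto_sum_nat
  simp_rw [hsum] at ht
  have ht' : Tendsto (fun N : ℕ => laurentCoeff e ω y N * z ^ N) atTop
      (nhds (e.repr y 0 - laurentTail (laurentCoeff e ω x) 0 z)) := by
    simpa using (tendsto_const_nhds (x := e.repr y 0)).sub ht
  refine sub_eq_zero.1 (eq_zero_of_tendsto_of_frequently_norm_le ht'
    (e.tendsto_repr_comp_zero y Nat.cast_injective) ?_)
  -- Whenever `‖z‖ ^ n ≤ β_n`, the remainder is at most the `n`-th coordinate of `y`, which tends to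
  -- zero. As the remainder converges, infinitely many such `n` suffice.
  refine (frequently_pow_le_shiftBeta (t := ‖z‖₊) h3).mono fun n hn => ?_
  rw [norm_mul, norm_laurentCoeff hω, norm_pow, div_mul_eq_mul_div,
    div_le_iff₀ (shiftBeta_pos hω n)]
  exact mul_le_mul_of_nonneg_left hn (norm_nonneg _)

/-- The same telescoping run towards `-∞`, with `r_2^-` supplying infinitely many indices at which
the remainder is dominated. -/
theorem IsBilateralWeightedShift.repr_zero_eq_neg_laurentHead
    (hS : IsBilateralWeightedShift S e ω)
    {y : H} {z : ℂ} (hz : z ≠ 0) (hy : S y - z • y = x) (h2 : rTwoMinus ω < ‖z‖ₑ)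
    (hs : Summable fun j : ℕ => laurentCoeff e ω x (0 - j) * (z ^ (j + 1))⁻¹) :
    e.repr y 0 = -laurentHead (laurentCoeff e ω x) 0 z := by
  have hω := hS.weight_pos
  have hsum : ∀ N : ℕ, ∑ j ∈ Finset.range N, laurentCoeff e ω x (0 - j) * (z ^ (j + 1))⁻¹ =
      laurentCoeff e ω y (-N) * z ^ (-N : ℤ) - e.repr y 0 := by
    intro N
    induction N with
    | zero => simp [laurentCoeff, shiftBeta]
    | succ N ih =>
      have := hS.normalized_coeff_sub hz hy (-N)
      have h4 : (z ^ (N + 1))⁻¹ = z ^ (-(N : ℤ) - 1) := by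
        rw [← neg_add', zpow_neg]
        norm_cast
      rw [Finset.sum_range_succ, ih, zero_sub, h4, ← this]
      push_cast
      rw [neg_add']
      ring
  have ht : Tendsto _ atTop (nhds (laurentHead (laurentCoeff e ω x) 0 z)) :=
    hs.hasSum.tendsto_sum_nat
  simp_rw [hsum] at ht
  have ht' : Tendsto (fun N : ℕ => laurentCoeff e ω y (-N) * z ^ (-N : ℤ)) atTop
      (nhds (laurentHead (laurentCoeff e ω x) 0 z + e.repr y 0)) := by
    simpa using ht.add_const (e.repr y 0)
  refine eq_neg_of_add_eq_zero_right (eq_zero_of_tendsto_of_frequently_norm_le ht'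
    (e.tendsto_repr_comp_zero y (neg_injective.comp Nat.cast_injective)) ?_)
  refine (frequently_one_le_shiftBeta_neg_mul_pow (t := ‖z‖₊) h2 hω).mono fun n hn => ?_
  have hzn : 0 < ‖z‖ ^ n := pow_pos (norm_pos_iff.2 hz) n
  rw [coe_nnnorm] at hn
  rw [norm_mul, norm_laurentCoeff hω, norm_zpow, zpow_neg, zpow_natCast, div_mul_eq_mul_div,
    div_le_iff₀ (shiftBeta_pos hω (-n)), ← div_eq_mul_inv, div_le_iff₀ hzn, mul_assoc]
  exact le_mul_of_one_le_right (norm_nonneg _) hn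

end Shift

/-! ### Approaching a point from either side of its circle -/

section Points

theorem tendsto_ofReal_mul_nhdsNE {z₀ : ℂ} (hz₀ : z₀ ≠ 0) :
    Tendsto (fun r : ℝ => (r : ℂ) * z₀) (nhdsWithin 1 {1}ᶜ) (nhdsWithin z₀ {z₀}ᶜ) := by
  refine tendsto_nhdsWithin_iff.2 ⟨?_, ?_⟩
  · have : Continuous fun r : ℝ => (r : ℂ) * z₀ := by fun_prop
    simpa using (this.tendsto 1).mono_left nhdsWithin_le_nhds
  · filter_upwards [self_mem_nhdsWithin] with r hr h
    exact hr (by exact_mod_cast mul_eq_right₀ hz₀ |>.1 h)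

theorem frequently_norm_lt {z₀ : ℂ} (hz₀ : z₀ ≠ 0) :
    ∃ᶠ z in nhdsWithin z₀ {z₀}ᶜ, ‖z‖ < ‖z₀‖ := by
  refine (tendsto_ofReal_mul_nhdsNE hz₀).frequently (Frequently.filter_mono
    (f := nhdsWithin 1 (Set.Iio 1)) ?_ (nhdsWithin_mono _ fun r hr => ne_of_lt hr))
  refine Eventually.frequently ?_
  filter_upwards [Ioo_mem_nhdsLT (zero_lt_one' ℝ)] with r hr
  rw [norm_mul, Complex.norm_of_nonneg hr.1.le]
  exact mul_lt_of_lt_one_left (norm_pos_iff.2 hz₀) hr.2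

theorem frequently_lt_norm {z₀ : ℂ} (hz₀ : z₀ ≠ 0) :
    ∃ᶠ z in nhdsWithin z₀ {z₀}ᶜ, ‖z₀‖ < ‖z‖ := by
  refine (tendsto_ofReal_mul_nhdsNE hz₀).frequently (Frequently.filter_mono
    (f := nhdsWithin 1 (Set.Ioi 1)) ?_ (nhdsWithin_mono _ fun r hr => ne_of_gt hr))
  refine Eventually.frequently ?_
  filter_upwards [self_mem_nhdsWithin] with r hr
  have hr : 1 < r := hr
  rw [norm_mul, Complex.norm_of_nonneg (zero_le_one.trans hr.le)]
  exact lt_mul_of_one_lt_left (norm_pos_iff.2 hz₀) hr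

end Points

/-! ### Points of the local spectrum -/

section Main

variable {H : Type*} [NormedAddCommGroup H] [InnerProductSpace ℂ H]
  {S : H →L[ℂ] H} {e : HilbertBasis ℤ ℂ H} {ω : ℤ → ℝ} {x : H}

theorem eq_zero_of_laurentCoeff_eq_zero (hω : ∀ n, 0 < ω n) (h : laurentCoeff e ω x = 0) :
    x = 0 := by
  have := e.hasSum_repr x
  simp_rw [← shiftBeta_mul_laurentCoeff hω, h, Pi.zero_apply, mul_zero, zero_smul] at this
  exact this.unique hasSum_zero

theorem enorm_lt_enorm_of_norm_lt {z w : ℂ} (h : ‖z‖ < ‖w‖) : ‖z‖ₑ < ‖w‖ₑ := by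
  simpa only [enorm, ENNReal.coe_lt_coe] using! (NNReal.coe_lt_coe.1 h : ‖z‖₊ < ‖w‖₊)

/-- The forced values are needed only at points accumulating at `z₀`, from inside its circle for the
tail and from outside for the head. This is why the boundary circles `‖z₀‖ = r_2^-` and `‖z₀‖ =
r_3^+` are allowed. -/
theorem IsBilateralWeightedShift.mem_localSpectrum (hS : IsBilateralWeightedShift S e ω)
    (hx : x ≠ 0) {z₀ : ℂ} (hz₀ : z₀ ≠ 0) (h1 : RMinus e ω x < ‖z₀‖ₑ) (h2 : ‖z₀‖ₑ < RPlus e ω x)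
    (h3 : rTwoMinus ω ≤ ‖z₀‖ₑ) (h4 : ‖z₀‖ₑ ≤ rThreePlus ω) : z₀ ∈ localSpectrum S x := by
  rintro ⟨U, ⟨hU, f, hf, hfx⟩, hz₀U⟩
  have hω := hS.weight_pos
  refine hx (eq_zero_of_laurentCoeff_eq_zero (e := e) hω ?_)
  obtain ⟨t, ht1, ht2⟩ := ENNReal.lt_iff_exists_nnreal_btwn.1 h1
  obtain ⟨q, hq1, hq2⟩ := ENNReal.lt_iff_exists_nnreal_btwn.1 h2
  obtain ⟨C, hC⟩ := exists_norm_laurentCoeff_le (x := x) hω ht1 (ht2.trans h2)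
  obtain ⟨D, hD⟩ := exists_norm_laurentCoeff_le (x := x) hω (h1.trans hq1) hq2
  have ht0 : (0 : ℝ) < t := by exact_mod_cast (zero_le : 0 ≤ RMinus e ω x).trans_lt ht1
  have htz : (t : ℝ) < ‖z₀‖ := by exact_mod_cast (ENNReal.coe_lt_coe.1 ht2 : t < ‖z₀‖₊)
  have hqz : ‖z₀‖ < (q : ℝ) := by exact_mod_cast (ENNReal.coe_lt_coe.1 hq1 : ‖z₀‖₊ < q)
  obtain ⟨s, hts, hsz⟩ := exists_between htz
  obtain ⟨p, hzp, hpq⟩ := exists_between hqz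
  have hp0 : 0 ≤ p := (norm_nonneg _).trans hzp.le
  have hT : AnalyticAt ℂ (laurentTail (laurentCoeff e ω x) 0) z₀ :=
    (differentiableOn_laurentTail hp0 hpq hD 0).analyticAt
      (Metric.isOpen_ball.mem_nhds (mem_ball_zero_iff.2 hzp))
  have hH : AnalyticAt ℂ (laurentHead (laurentCoeff e ω x) 0) z₀ :=
    (differentiableOn_laurentHead ht0 hts hC 0).analyticAt ((isOpen_lt_norm s).mem_nhds hsz)
  have hf0 : AnalyticAt ℂ (fun z => e.repr (f z) 0) z₀ := by
    simp_rw [HilbertBasis.repr_apply_apply]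
    exact ((innerSL ℂ (e 0)).analyticAt _).comp (hf z₀ hz₀U)
  have hev : ∀ᶠ z in nhdsWithin z₀ {z₀}ᶜ, z ∈ U ∧ s < ‖z‖ ∧ ‖z‖ < p :=
    nhdsWithin_le_nhds ((hU.inter ((isOpen_lt_norm s).inter
      (isOpen_lt continuous_norm continuous_const))).mem_nhds ⟨hz₀U, hsz, hzp⟩)
  have hs0 : 0 < s := ht0.trans hts
  -- The identity theorem turns equality at accumulating points into equality on a full
  -- neighbourhood.
  have e1 := (hf0.frequently_eq_iff_eventually_eq hT).1 <|
    ((frequently_norm_lt hz₀).and_eventually hev).mono fun z ⟨hz, hzU, hz1, hz2⟩ =>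
      hS.repr_zero_eq_laurentTail (norm_pos_iff.1 (hs0.trans hz1)) (hfx z hzU)
        ((enorm_lt_enorm_of_norm_lt hz).trans_le h4) (summable_laurentTail hp0 hpq hD 0 hz2.le)
  have e2 := (hf0.frequently_eq_iff_eventually_eq hH.neg).1 <|
    ((frequently_lt_norm hz₀).and_eventually hev).mono fun z ⟨hz, hzU, hz1, hz2⟩ =>
      hS.repr_zero_eq_neg_laurentHead (norm_pos_iff.1 (hs0.trans hz1)) (hfx z hzU)
        (h3.trans_lt (enorm_lt_enorm_of_norm_lt hz)) (summable_laurentHead ht0 hts hC 0 hz1.le)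
  refine laurent_coeff_eq_zero ht0 hC hD htz hqz ?_
  filter_upwards [e1, e2] with z h h'
  rw [← h, h', Pi.neg_apply, neg_add_cancel]

end Main

theorem theorem4 {H : Type*} [NormedAddCommGroup H] [InnerProductSpace ℂ H] [CompleteSpace H]
    (S : H →L[ℂ] H) (e : HilbertBasis ℤ ℂ H) (ω : ℤ → ℝ)
    (hS : IsBilateralWeightedShift S e ω)
    (hr : rTwoMinus ω ≤ rThreePlus ω) (x : H) (hx : x ≠ 0) :
    ((RMinus e ω x < rTwoMinus ω ∧ rThreePlus ω < RPlus e ω x) →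
      localSpectrum S x = {l : ℂ | rTwoMinus ω ≤ ‖l‖ₑ ∧ ‖l‖ₑ ≤ rThreePlus ω}) ∧
    (¬ (RMinus e ω x < rTwoMinus ω ∧ rThreePlus ω < RPlus e ω x) →
      {l : ℂ | max (RMinus e ω x) (rTwoMinus ω) < ‖l‖ₑ ∧
        ‖l‖ₑ < min (RPlus e ω x) (rThreePlus ω)} ⊆ localSpectrum S x) := by
  constructor
  · rintro ⟨h1, h2⟩
    refine Set.Subset.antisymm (fun l hl => ⟨?_, ?_⟩) fun l hl => ?_
    · by_contra! h
      obtain ⟨q, hq1, hq2⟩ := ENNReal.lt_iff_exists_nnreal_btwn.1 h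
      refine hl (hS.ball_subset_localResolventSet hr h1 h2 hq2 (mem_ball_zero_iff.2 ?_))
      exact_mod_cast (ENNReal.coe_lt_coe.1 hq1 : ‖l‖₊ < q)
    · by_contra! h
      obtain ⟨q, hq1, hq2⟩ := ENNReal.lt_iff_exists_nnreal_btwn.1 h
      refine hl (hS.lt_norm_subset_localResolventSet hr h1 h2 hq1 (?_ : (q : ℝ) < ‖l‖))
      exact_mod_cast (ENNReal.coe_lt_coe.1 hq2 : q < ‖l‖₊)
    · exact hS.mem_localSpectrum hx
        -- The origin is excluded because `R_ω^-(x) < r_2^-` forces `r_2^- > 0`.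
        (enorm_pos.1 ((zero_le : 0 ≤ RMinus e ω x).trans_lt (h1.trans_le hl.1)))
        (h1.trans_le hl.1) (hl.2.trans_lt h2) hl.1 hl.2
  · rintro - l ⟨hl1, hl2⟩
    exact hS.mem_localSpectrum hx
      (enorm_pos.1 ((zero_le : 0 ≤ max (RMinus e ω x) (rTwoMinus ω)).trans_lt hl1))
      ((le_max_left _ _).trans_lt hl1) (hl2.trans_le (min_le_left _ _))
      ((le_max_right _ _).trans hl1.le) (hl2.le.trans (min_le_right _ _))
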